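/- Consider the product-free Lambek calculus $\mathbf{L}^{\Lambda}(\backslash,/)$ allowing empty antecedents. Its formulae are built from variables $p_0,p_1,\dots$ by the two divisions $\backslash$ and $/$; its sequents have the form $\Pi\to A$, where $A$ is a formula and $\Pi$ is a finite, possibly empty, sequence of formulae; its axioms are $A\to A$; and its rules are: \begin{itemize} \item from $\Pi\to A$ and $\Gamma,B,\Delta\to C$ infer $\Gamma,\Pi,A\backslash B,\Delta\to C$, and also infer $\Gamma,B/A,\Pi,\Delta\to C$; \item from $A,\Pi\to B$ infer $\Pi\to A\backslash B$; \item from $\Pi,A\to B$ infer $\Pi\to B/A$; \item (cut) from $\Pi\to A$ and $\Gamma,A,\Delta\to C$ infer $\Gamma,\Pi,\Delta\to C$. \end{itemize} There is no non-emptiness restriction on antecedents in any rule. An $\mathbf{L}^{\Lambda}(\backslash,/)$-grammar over a finite alphabet $\Sigma$ consists of a formula $H$ (the goal type) and a finite relation $\rhd$ between letters of $\Sigma$ and formulae. It generates the language of all words $a_1\dots a_n$ over $\Sigma$ for which there are formulae $A_1,\dots,A_n$ with $a_i\rhd A_i$ for $i=1,\dots,n$ and with $A_1,\dots,A_n\to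 H$ derivable. It has unique type assignment if for every $a\in\Sigma$ there is exactly one formula $A$ with $a\rhd A$. **Theorem.** Every context-free grammar without $\varepsilon$-rules can be algorithmically transformed into an $\mathbf{L}^{\Lambda}(\backslash,/)$-grammar with unique type assignment over the same alphabet which generates the same language. That is, there is a single computable function that takes as input a context-free grammar (its finite terminal alphabet, its starting symbol and its finite list of production rules, where terminal and non-terminal symbols are given by codes) and, whenever the input has no $\varepsilon$-rules, outputs such an $\mathbf{L}^{\Lambda}(\backslash,/)$-grammar. -/

import Mathlib

/-! ### The product-free Lambek calculus allowing empty antecedents -/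

/-- Formulae built from the variables `p₀, p₁, …` by the two divisions:
`ldiv A B` is `A \ B` and `rdiv B A` is `B / A`. -/
inductive LForm : Type
  | var : ℕ → LForm
  | ldiv : LForm → LForm → LForm
  | rdiv : LForm → LForm → LForm

/-- Derivability of a sequent `Γ → A`; the antecedent `Γ` is an arbitrary, possibly empty, list.
There is no non-emptiness condition on any rule. -/
inductive LDer : List LForm → LForm → Prop
  | ax (A : LForm) : LDer [A] A
  | ldivL {Γ P Δ : List LForm} {A B C : LForm} :
      LDer P A → LDer (Γ ++ [B] ++ Δ) C → LDer (Γ ++ P ++ [LForm.ldiv A B] ++ Δ) C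
  | ldivR {P : List LForm} {A B : LForm} :
      LDer ([A] ++ P) B → LDer P (LForm.ldiv A B)
  | rdivL {Γ P Δ : List LForm} {A B C : LForm} :
      LDer P A → LDer (Γ ++ [B] ++ Δ) C → LDer (Γ ++ [LForm.rdiv B A] ++ P ++ Δ) C
  | rdivR {P : List LForm} {A B : LForm} :
      LDer (P ++ [A]) B → LDer P (LForm.rdiv B A)
  | cut {Γ P Δ : List LForm} {A C : LForm} :
      LDer P A → LDer (Γ ++ [A] ++ Δ) C → LDer (Γ ++ P ++ Δ) C

/-! ### Gödel numbering of formulae -/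

namespace LForm

/-- The code of a formula; `Nat.pair` is the pairing function. -/
def toNat : LForm → ℕ
  | var n => 3 * n
  | ldiv A B => 3 * Nat.pair A.toNat B.toNat + 1
  | rdiv B A => 3 * Nat.pair B.toNat A.toNat + 2

/-- The formula with a given code. -/
def ofNat (n : ℕ) : LForm :=
  if n % 3 = 0 then var (n / 3)
  else if h : n % 3 = 1 then
    have h1 : (n / 3).unpair.1 < n := lt_of_le_of_lt (Nat.unpair_left_le _) (by omega)
    have h2 : (n / 3).unpair.2 < n := lt_of_le_of_lt (Nat.unpair_right_le _) (by omega)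
    ldiv (ofNat (n / 3).unpair.1) (ofNat (n / 3).unpair.2)
  else if h' : n % 3 = 2 then
    have h1 : (n / 3).unpair.1 < n := lt_of_le_of_lt (Nat.unpair_left_le _) (by omega)
    have h2 : (n / 3).unpair.2 < n := lt_of_le_of_lt (Nat.unpair_right_le _) (by omega)
    rdiv (ofNat (n / 3).unpair.1) (ofNat (n / 3).unpair.2)
  else var 0
termination_by n

theorem ofNat_toNat (A : LForm) : ofNat A.toNat = A := by
  induction A with
  | var n => rw [toNat, ofNat]; simp
  | ldiv A B hA hB =>
    have e1 : (3 * Nat.pair A.toNat B.toNat + 1) % 3 = 1 := by omega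
    have e2 : (3 * Nat.pair A.toNat B.toNat + 1) / 3 = Nat.pair A.toNat B.toNat := by omega
    rw [toNat, ofNat]; simp [e1, e2, hA, hB]
  | rdiv B A hB hA =>
    have e1 : (3 * Nat.pair B.toNat A.toNat + 2) % 3 = 2 := by omega
    have e2 : (3 * Nat.pair B.toNat A.toNat + 2) / 3 = Nat.pair B.toNat A.toNat := by omega
    rw [toNat, ofNat]; simp [e1, e2, hA, hB]

theorem toNat_ofNat (n : ℕ) : (ofNat n).toNat = n := by
  induction n using Nat.strong_induction_on with
  | _ n ih =>
    have hl : 0 < n → (n / 3).unpair.1 < n := fun h =>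
      lt_of_le_of_lt (Nat.unpair_left_le _) (by omega)
    have hr : 0 < n → (n / 3).unpair.2 < n := fun h =>
      lt_of_le_of_lt (Nat.unpair_right_le _) (by omega)
    have hmod : n % 3 = 0 ∨ n % 3 = 1 ∨ n % 3 = 2 := by omega
    rcases hmod with h | h | h
    · rw [ofNat]; simp [h, toNat]; omega
    · rw [ofNat]; simp [h, toNat, ih _ (hl (by omega)), ih _ (hr (by omega))]; omega
    · rw [ofNat]; simp [h, toNat, ih _ (hl (by omega)), ih _ (hr (by omega))]; omega

instance : Denumerable LForm :=
  Denumerable.mk' ⟨toNat, ofNat, ofNat_toNat, toNat_ofNat⟩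

end LForm

/-! ### Lambek grammars -/

/-- A Lambek grammar over a finite alphabet: the (listed) alphabet, the goal type, and the finite
correspondence between letters and formulae, given as the list of its pairs. All formulae are
product-free. -/
structure LambekGrammar (T : Type*) where
  alphabet : List T
  goal : LForm
  assign : List (T × LForm)

namespace LambekGrammar

variable {T : Type*}

/-- Types are assigned to letters of the alphabet only. -/
def WellFormed (L : LambekGrammar T) : Prop :=
  ∀ p ∈ L.assign, p.1 ∈ L.alphabet

/-- Every letter of the alphabet corresponds to exactly one formula. -/
def UniqueType (L : LambekGrammar T) : Prop :=
  ∀ a ∈ L.alphabet, ∃! A : LForm, (a, A) ∈ L.assign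

/-- The words `a₁ … aₙ` with `A₁, …, Aₙ → H` derivable for some formulae `Aᵢ` assigned to `aᵢ`. -/
def language (L : LambekGrammar T) : Language T :=
  {w | ∃ Γ : List LForm, List.Forall₂ (fun a A => (a, A) ∈ L.assign) w Γ ∧ LDer Γ L.goal}

end LambekGrammar

/-! ### Context-free grammars as finite data -/

/-- A context-free grammar over a finite alphabet, as an input for an algorithm: the listed
terminal alphabet, the starting symbol and the list of production rules. Terminals and
non-terminals are kept apart by the constructors of `Symbol`. -/
structure CFGData (T N : Type*) where
  alphabet : List T
  start : N
  rules : List (ContextFreeRule T N)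

namespace CFGData

/-- The terminals in the production rules are letters of the alphabet. -/
def WellFormed {T N : Type*} (G : CFGData T N) : Prop :=
  ∀ r ∈ G.rules, ∀ a : T, Symbol.terminal a ∈ r.output → a ∈ G.alphabet

/-- There are no ε-rules. -/
def EpsilonFree {T N : Type*} (G : CFGData T N) : Prop :=
  ∀ r ∈ G.rules, r.output ≠ []

open Classical in
/-- The context-free grammar given by the data. -/
noncomputable def toGrammar {T : Type*} {N : Type} (G : CFGData T N) : ContextFreeGrammar T where
  NT := N
  initial := G.start
  rules := G.rules.toFinset

end CFGData

/-! ### Codes of grammars, by tupling -/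

/-- A symbol is a terminal or a non-terminal. -/
def symbolEquivSum (T N : Type*) : Symbol T N ≃ T ⊕ N where
  toFun
    | Symbol.terminal a => Sum.inl a
    | Symbol.nonterminal n => Sum.inr n
  invFun
    | Sum.inl a => Symbol.terminal a
    | Sum.inr n => Symbol.nonterminal n
  left_inv s := by cases s <;> rfl
  right_inv s := by cases s <;> rfl

instance {T N : Type*} [Primcodable T] [Primcodable N] : Primcodable (Symbol T N) :=
  Primcodable.ofEquiv _ (symbolEquivSum T N)

/-- A rule is the pair of its two sides. -/
def ruleEquivProd (T N : Type*) : ContextFreeRule T N ≃ N × List (Symbol T N) where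
  toFun r := (r.input, r.output)
  invFun p := ⟨p.1, p.2⟩
  left_inv _ := rfl
  right_inv _ := rfl

instance {T N : Type*} [Primcodable T] [Primcodable N] : Primcodable (ContextFreeRule T N) :=
  Primcodable.ofEquiv _ (ruleEquivProd T N)

/-- Grammar data is the triple of its components. -/
def cfgDataEquivProd (T N : Type*) :
    CFGData T N ≃ List T × N × List (ContextFreeRule T N) where
  toFun G := (G.alphabet, G.start, G.rules)
  invFun p := ⟨p.1, p.2.1, p.2.2⟩
  left_inv _ := rfl
  right_inv _ := rfl

instance {T N : Type*} [Primcodable T] [Primcodable N] : Primcodable (CFGData T N) :=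
  Primcodable.ofEquiv _ (cfgDataEquivProd T N)

/-- A Lambek grammar is the triple of its components. -/
def lambekGrammarEquivProd (T : Type*) :
    LambekGrammar T ≃ List T × LForm × List (T × LForm) where
  toFun L := (L.alphabet, L.goal, L.assign)
  invFun p := ⟨p.1, p.2.1, p.2.2⟩
  left_inv _ := rfl
  right_inv _ := rfl

instance {T : Type*} [Primcodable T] : Primcodable (LambekGrammar T) :=
  Primcodable.ofEquiv _ (lambekGrammarEquivProd T)

/-! ### Derived rules of the Lambek calculus -/

namespace LDer

/-! The single type of a letter must offer every grammar rule and let each offer be declined. A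
phrase of kind `A` has the type `base / cont A`, and an optional rule `r` has the type `base /
choice r`, where `choice r` is a common upper bound of `base` (the rule is skipped, since `option r,
base` yields `base`) and of the product of the phrases of `r.2` with `cont r.1` (the rule is used).

There is no disjunction to form this upper bound, so it is obtained from a common lower bound.
Fillers followed by `lower r.1` lie below both alternatives. Division is antitone in its
denominator, so the quotients `skipArg r` and `useArg r` of a fresh atom have the common upper bound
`bound r`. Two formulae with a common upper bound also have a common lower bound, the product `meet
r`. Dividing the atom by that product gives `choice r`.

A letter carries `K` copies of the whole menu of rules in front of its own phrase (`letter`). This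
suffices if the grammar can be expanded from left to right with at most `K` steps before each letter
(`Accepts.lder`). Left recursion and unit cycles obstruct this, so the grammar is first put into
left-corner form: leftmost branches are read bottom-up, and unit chains are shortened to
repetition-free ones. Then `K = 2 * |rules| + 4` is enough (`expandable_of_yields`).

Conversely, formulae are interpreted by languages over generators that include one for every rule.
The model is built so that `phrase A` denotes exactly the words expanding `A`, with rule generators
either applied or skipped (`mem_phrase`), while the type of a letter contains the word listing its
menu and then the letter. A derivable sequent therefore yields an expansion (`expands_of_lder`), and
soundness of the left-corner rules turns it into a derivation of the original grammar
(`Reads.mem_labelsWords`). -/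

theorem cut_cons {Γ P Δ : List LForm} {A C : LForm} (h : LDer P A) (h' : LDer (Γ ++ A :: Δ) C) :
    LDer (Γ ++ (P ++ Δ)) C := by
  have := LDer.cut (Γ := Γ) (Δ := Δ) h (by simpa using h')
  simpa using this

theorem cut_head {P Δ : List LForm} {A C : LForm} (h : LDer P A) (h' : LDer (A :: Δ) C) :
    LDer (P ++ Δ) C := cut_cons (Γ := []) h h'

theorem trans {P : List LForm} {A C : LForm} (h : LDer P A) (h' : LDer [A] C) : LDer P C := by
  simpa using cut_head h h'

theorem rdiv_elim {Γ Δ : List LForm} {A B : LForm} (h : LDer Γ (.rdiv B A)) (h' : LDer Δ A) :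
    LDer (Γ ++ Δ) B := by
  have : LDer (.rdiv B A :: Δ) B := by
    simpa using LDer.rdivL (Γ := []) (Δ := []) h' (by simpa using LDer.ax B)
  exact cut_head h this

theorem ldiv_elim {Γ Δ : List LForm} {A B : LForm} (h' : LDer Δ A) (h : LDer Γ (.ldiv A B)) :
    LDer (Δ ++ Γ) B := by
  have : LDer (Δ ++ [.ldiv A B]) B := by
    simpa using LDer.ldivL (Γ := []) (Δ := []) h' (by simpa using LDer.ax B)
  simpa using cut_cons (Δ := []) h this

/-- Replacing formulae of the antecedent by stronger ones. -/
theorem forall₂_mono {Θ Θ' : List LForm} (h : List.Forall₂ (fun A B => LDer [A] B) Θ Θ')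
    {Γ Δ : List LForm} {C : LForm} (hd : LDer (Γ ++ (Θ' ++ Δ)) C) : LDer (Γ ++ (Θ ++ Δ)) C := by
  induction h generalizing Γ with
  | nil => exact hd
  | @cons A B l l' hAB _ ih =>
    have h1 : LDer (Γ ++ ([A] ++ (l' ++ Δ))) C := cut_cons hAB (by simpa using hd)
    have := ih (Γ := Γ ++ [A]) (by simpa using h1)
    simpa using this

end LDer

namespace LForm

/-- `lunder [A₁, …, Aₙ] B` is `Aₙ \ (… \ (A₁ \ B))`, the division of `B` by the product
of a list of formulae. -/
def lunder (l : List LForm) (B : LForm) : LForm :=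
  l.foldl (fun acc A => ldiv A acc) B

theorem lder_lunder {l Γ : List LForm} {B : LForm} :
    LDer Γ (lunder l B) ↔ LDer (l ++ Γ) B := by
  induction l generalizing B with
  | nil => rfl
  | cons A l ih =>
    change LDer Γ (lunder l (ldiv A B)) ↔ _
    rw [ih]
    constructor
    · intro h
      simpa using LDer.ldiv_elim (LDer.ax A) h
    · intro h
      exact LDer.ldivR (by simpa using h)

end LForm

namespace Menu

/-! ### Expansion with a bounded number of steps per letter -/

/-- `Accepts R K k Θ w`: the list of symbols `Θ` can be expanded from left to right to `w` by
rules of `R`, with at most `k` steps before the first letter and at most `K` steps before each of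
the following letters. -/
inductive Accepts {ι : Type*} (R : List (ι × List ι)) (K : ℕ) : ℕ → List ι → List ι → Prop
  | nil (k : ℕ) : Accepts R K k [] []
  | shift (k : ℕ) {A : ι} {Θ w : List ι} : Accepts R K K Θ w → Accepts R K k (A :: Θ) (A :: w)
  | step {k : ℕ} {A B : ι} {l Θ w : List ι} : (A, B :: l) ∈ R →
      Accepts R K k (B :: l ++ Θ) w → Accepts R K (k + 1) (A :: Θ) w

namespace Accepts

variable {ι : Type*} {R : List (ι × List ι)} {K : ℕ}

theorem mono {k k' : ℕ} {Θ w : List ι} (h : Accepts R K k Θ w) (hk : k ≤ k') :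
    Accepts R K k' Θ w := by
  induction h generalizing k' with
  | nil => exact nil _
  | shift _ h => exact shift _ h
  | step hr _ ih =>
    obtain ⟨j, rfl⟩ : ∃ j, k' = j + 1 := ⟨k' - 1, by omega⟩
    exact step hr (ih (by omega))

theorem eq_nil {k : ℕ} {Θ w : List ι} (h : Accepts R K k Θ w) (hw : w = []) : Θ = [] := by
  induction h with
  | nil => rfl
  | shift => simp at hw
  | step _ _ ih => simpa using ih hw

end Accepts

/-! ### Types for expansion rules -/

open LForm

variable {ι : Type*} [Encodable ι]

/-- The atom in which all types of grammar symbols end. -/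
def base : LForm := var 0

/-- The auxiliary atom for raised types. -/
def raising : LForm := var 1

/-- The atom marking a grammar symbol. -/
def mark (A : ι) : LForm := var (2 * Encodable.encode A + 2)

/-- The atom reserved for an expansion rule. -/
def ruleAtom (r : ι × List ι) : LForm := var (2 * Encodable.encode r + 3)

/-- A common lower bound of `base` and `cont A`. -/
def lower (A : ι) : LForm := ldiv (rdiv (mark A) (mark A)) base

/-- The continuation type awaited by a phrase of kind `A`. -/
def cont (A : ι) : LForm := rdiv raising (ldiv (lower A) raising)

/-- The type of phrases of kind `A`. -/
def phrase (A : ι) : LForm := rdiv base (cont A)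

/-- A common upper bound of `base` and of all `cont A`. -/
def upper : LForm := rdiv raising (ldiv base raising)

/-- A common lower bound of `base / base` and of all `phrase A`. -/
def filler : LForm := rdiv base upper

/-- The division of the rule atom by `base`. -/
def skipArg (r : ι × List ι) : LForm := ldiv base (ruleAtom r)

/-- The division of the rule atom by the right-hand side of the rule. -/
def useArg (r : ι × List ι) : LForm := lunder (r.2.map phrase ++ [cont r.1]) (ruleAtom r)

/-- A common upper bound of `skipArg r` and `useArg r`. -/
def bound (r : ι × List ι) : LForm :=
  lunder (r.2.map (fun _ => filler) ++ [lower r.1]) (ruleAtom r)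

/-- A common upper bound of `base` and of the product of the right-hand side of the rule. -/
def choice (r : ι × List ι) : LForm :=
  rdiv (rdiv (rdiv (ruleAtom r) (ldiv (bound r) (useArg r))) (bound r))
    (rdiv (skipArg r) (bound r))

/-- The type of a rule which may be used for expanding `r.1` to `r.2`, or may be skipped. -/
def option (r : ι × List ι) : LForm := rdiv base (choice r)

/-- The type of a letter of kind `A` which is preceded by a list of optional rules. -/
def letter (bl : List (ι × List ι)) (A : ι) : LForm :=
  rdiv base (lunder (bl.map option ++ [phrase A]) base)

/-- The denominator `mark A / mark A` is derivable from the empty antecedent, so this depends on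
having no non-emptiness restriction. -/
theorem lower_base (A : ι) : LDer [lower A] base :=
  LDer.ldiv_elim (Δ := []) (LDer.rdivR (LDer.ax (mark A))) (LDer.ax (lower A))

theorem lower_cont (A : ι) : LDer [lower A] (cont A) :=
  LDer.rdivR (LDer.ldiv_elim (LDer.ax (lower A)) (LDer.ax _))

theorem base_upper : LDer [base] upper :=
  LDer.rdivR (LDer.ldiv_elim (LDer.ax base) (LDer.ax _))

/-- Both formulae are raisings, and raising is monotone; the inequality comes from `lower_base`. -/
theorem cont_upper (A : ι) : LDer [cont A] upper := by
  refine LDer.rdivR (LDer.rdiv_elim (LDer.ax (cont A)) (LDer.ldivR ?_))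
  exact LDer.ldiv_elim (lower_base A) (LDer.ax _)

theorem filler_base : LDer [filler, base] base :=
  LDer.rdiv_elim (LDer.ax filler) base_upper

theorem filler_phrase (A : ι) : LDer [filler] (phrase A) :=
  LDer.rdivR (LDer.rdiv_elim (LDer.ax filler) (cont_upper A))

/-- Each filler is absorbed by the `base` to its right. Together with `fillers_lower_product` this
gives the common lower bound of the two alternatives of a rule, and hence `bound r`. -/
theorem fillers_lower {κ : Type*} (l : List κ) (A : ι) :
    LDer (l.map (fun _ => filler) ++ [lower A]) base := by
  induction l with
  | nil => exact lower_base A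
  | cons _ l ih => simpa using LDer.cut_cons (Γ := [filler]) (Δ := []) ih filler_base

theorem fillers_lower_product (r : ι × List ι) :
    List.Forall₂ (fun A B => LDer [A] B) (r.2.map (fun _ => filler) ++ [lower r.1])
      (r.2.map phrase ++ [cont r.1]) := by
  induction r.2 with
  | nil => simpa using lower_cont r.1
  | cons B l ih => simpa using ⟨filler_phrase B, by simpa using ih⟩

theorem skipArg_bound (r : ι × List ι) : LDer [skipArg r] (bound r) := by
  rw [bound, lder_lunder]
  exact LDer.ldiv_elim (fillers_lower r.2 r.1) (LDer.ax _)

theorem useArg_bound (r : ι × List ι) : LDer [useArg r] (bound r) := by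
  rw [bound, lder_lunder]
  have h : LDer ((r.2.map phrase ++ [cont r.1]) ++ [useArg r]) (ruleAtom r) := by
    rw [← lder_lunder]; exact LDer.ax _
  exact LDer.forall₂_mono (Γ := []) (fillers_lower_product r) h

/-- The lower bound of `skipArg r` and `useArg r`, as a product. -/
def meet (r : ι × List ι) : List LForm :=
  [rdiv (skipArg r) (bound r), bound r, ldiv (bound r) (useArg r)]

/-- The last two factors cancel to `useArg r`, which lies below `bound r`, and then the first factor
cancels. The other projection is the mirror image. -/
theorem meet_skipArg (r : ι × List ι) : LDer (meet r) (skipArg r) := by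
  have h : LDer [bound r, ldiv (bound r) (useArg r)] (bound r) :=
    (LDer.ldiv_elim (LDer.ax (bound r)) (LDer.ax _)).trans (useArg_bound r)
  exact LDer.rdiv_elim (LDer.ax (rdiv (skipArg r) (bound r))) h

theorem meet_useArg (r : ι × List ι) : LDer (meet r) (useArg r) := by
  have h : LDer [rdiv (skipArg r) (bound r), bound r] (bound r) :=
    (LDer.rdiv_elim (LDer.ax _) (LDer.ax (bound r))).trans (skipArg_bound r)
  exact LDer.ldiv_elim h (LDer.ax (ldiv (bound r) (useArg r)))

theorem lder_choice {r : ι × List ι} {Γ : List LForm} (h : LDer (Γ ++ meet r) (ruleAtom r)) :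
    LDer Γ (choice r) :=
  LDer.rdivR (LDer.rdivR (LDer.rdivR (by simpa [meet] using h)))

theorem base_choice (r : ι × List ι) : LDer [base] (choice r) :=
  lder_choice (LDer.ldiv_elim (LDer.ax base) (meet_skipArg r))

theorem product_choice (r : ι × List ι) :
    LDer (r.2.map phrase ++ [cont r.1]) (choice r) :=
  lder_choice (lder_lunder.1 (meet_useArg r))

/-- In front of `cont A` the phrase becomes `base`, one of the two alternatives below `choice r`. -/
theorem option_skip (r : ι × List ι) {Γ : List LForm} {A : ι} (h : LDer Γ (phrase A)) :
    LDer (option r :: Γ) (phrase A) := by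
  refine LDer.rdivR (LDer.rdiv_elim (Γ := [option r]) (LDer.ax (option r)) ?_)
  exact (LDer.rdiv_elim h (LDer.ax (cont A))).trans (base_choice r)

theorem options_skip (l : List (ι × List ι)) {Γ : List LForm} {A : ι} (h : LDer Γ (phrase A)) :
    LDer (l.map option ++ Γ) (phrase A) := by
  induction l with
  | nil => exact h
  | cons r l ih => exact option_skip r ih

theorem option_use (r : ι × List ι) : LDer (option r :: r.2.map phrase) (phrase r.1) := by
  refine LDer.rdivR (LDer.rdiv_elim (Γ := [option r]) (LDer.ax (option r)) ?_)
  exact product_choice r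

theorem letter_elim {bl : List (ι × List ι)} {A B : ι} {Γ : List LForm}
    (h : LDer (bl.map option ++ [phrase A] ++ Γ) (phrase B)) :
    LDer (letter bl A :: Γ) (phrase B) := by
  refine LDer.rdivR (LDer.rdiv_elim (Γ := [letter bl A]) (LDer.ax (letter bl A)) ?_)
  rw [lder_lunder]
  simpa using LDer.rdiv_elim h (LDer.ax (cont B))

/-! ### Bounded expansions give derivable sequents -/

namespace Accepts

variable {R : List (ι × List ι)} {K : ℕ}

/-- One copy of `R` pays for one expansion step: the chosen rule is used and the rest of the copy is
skipped. `Θ'` collects the symbols pushed behind the letter by these steps. Since right-hand sides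
are nonempty, the letter always comes from the head `B` of the stack. -/
theorem exists_letter {k : ℕ} {Θ w : List ι} (h : Accepts R K k Θ w) {A : ι} {v : List ι}
    (hw : w = A :: v) : ∃ B Θ₀ Θ', Θ = B :: Θ₀ ∧ Accepts R K K (Θ' ++ Θ₀) v ∧
      LDer (((List.replicate k R).flatten).map option ++ [phrase A] ++ Θ'.map phrase)
        (phrase B) := by
  induction h with
  | nil => simp at hw
  | @shift k B Θ u h =>
    obtain ⟨rfl, rfl⟩ : B = A ∧ u = v := by simpa using hw
    refine ⟨B, Θ, [], rfl, h, ?_⟩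
    simpa using options_skip (List.replicate k R).flatten (LDer.ax (phrase B))
  | @step k A' B l Θ u hr _ ih =>
    obtain ⟨B', Θ₀, Θ', he, ha, hd⟩ := ih hw
    obtain ⟨rfl, rfl⟩ : B = B' ∧ l ++ Θ = Θ₀ := by simpa using he
    refine ⟨A', Θ, Θ' ++ l, rfl, by simpa using ha, ?_⟩
    -- Earlier expansions stand further left. Thus `R₂` is skipped in front of the first symbol of
    -- the right-hand side, and `R₁` in front of the phrase completed by the rule.
    obtain ⟨R₁, R₂, rfl⟩ := List.append_of_mem hr
    have h1 := LDer.cut_cons (Γ := [option (A', B :: l)]) (Δ := l.map phrase)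
      (options_skip R₂ hd) (option_use (A', B :: l))
    have h2 := options_skip R₁ h1
    simpa [List.replicate_succ] using h2

theorem lder {Θ w : List ι} (h : Accepts R K K Θ w) {Γ : List LForm} {C : LForm}
    (hd : LDer (Γ ++ Θ.map phrase) C) :
    LDer (Γ ++ w.map (letter (List.replicate K R).flatten)) C := by
  induction w generalizing Θ Γ with
  | nil => obtain rfl := h.eq_nil rfl; exact hd
  | cons A v ih =>
    obtain ⟨B, Θ₀, Θ', rfl, ha, hl⟩ := h.exists_letter rfl
    have h1 := LDer.cut_cons (Δ := Θ₀.map phrase) (letter_elim hl) hd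
    have h2 := ih (Γ := Γ ++ [letter (List.replicate K R).flatten A]) ha (by simpa using h1)
    simpa using h2

end Accepts

end Menu

/-! ### Language models -/

namespace LForm

variable {α : Type*}

/-- The interpretation of formulae by languages, given the languages of the atoms. -/
def interp (v : ℕ → Set (List α)) : LForm → Set (List α)
  | var n => v n
  | ldiv A B => {x | ∀ w ∈ interp v A, w ++ x ∈ interp v B}
  | rdiv B A => {x | ∀ w ∈ interp v A, x ++ w ∈ interp v B}

/-- The interpretation of antecedents by products of languages. -/
def interpList (v : ℕ → Set (List α)) : List LForm → Set (List α)
  | [] => {[]}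
  | A :: Γ => {x | ∃ a ∈ interp v A, ∃ b ∈ interpList v Γ, x = a ++ b}

variable {v : ℕ → Set (List α)}

theorem mem_interpList_append {Γ Δ : List LForm} {x : List α} :
    x ∈ interpList v (Γ ++ Δ) ↔ ∃ a ∈ interpList v Γ, ∃ b ∈ interpList v Δ, x = a ++ b := by
  induction Γ generalizing x with
  | nil => simp [interpList]
  | cons A Γ ih =>
    constructor
    · rintro ⟨a, ha, b, hb, rfl⟩
      obtain ⟨b₁, h₁, b₂, h₂, rfl⟩ := ih.1 hb
      exact ⟨a ++ b₁, ⟨a, ha, b₁, h₁, rfl⟩, b₂, h₂, by simp⟩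
    · rintro ⟨_, ⟨a, ha, b, hb, rfl⟩, c, hc, rfl⟩
      exact ⟨a, ha, b ++ c, ih.2 ⟨b, hb, c, hc, rfl⟩, by simp⟩

theorem mem_interpList_singleton {A : LForm} {x : List α} :
    x ∈ interpList v [A] ↔ x ∈ interp v A := by
  simp [interpList]

theorem _root_.LDer.interpList_subset {Γ : List LForm} {A : LForm} (h : LDer Γ A) :
    interpList v Γ ⊆ interp v A := by
  induction h with
  | ax A => exact fun x hx => mem_interpList_singleton.1 hx
  | ldivL _ _ ih₁ ih₂ =>
    intro x hx
    simp only [mem_interpList_append, mem_interpList_singleton] at hx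
    obtain ⟨_, ⟨_, ⟨a, ha, p, hp, rfl⟩, f, hf, rfl⟩, d, hd, rfl⟩ := hx
    refine ih₂ ?_
    simp only [mem_interpList_append, mem_interpList_singleton]
    exact ⟨_, ⟨a, ha, p ++ f, hf p (ih₁ hp), rfl⟩, d, hd, by simp⟩
  | ldivR _ ih =>
    intro x hx w hw
    exact ih ⟨w, hw, x, hx, rfl⟩
  | rdivL _ _ ih₁ ih₂ =>
    intro x hx
    simp only [mem_interpList_append, mem_interpList_singleton] at hx
    obtain ⟨_, ⟨_, ⟨a, ha, f, hf, rfl⟩, p, hp, rfl⟩, d, hd, rfl⟩ := hx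
    refine ih₂ ?_
    simp only [mem_interpList_append, mem_interpList_singleton]
    exact ⟨_, ⟨a, ha, f ++ p, hf p (ih₁ hp), rfl⟩, d, hd, by simp⟩
  | rdivR _ ih =>
    intro x hx w hw
    exact ih (mem_interpList_append.2 ⟨x, hx, w, mem_interpList_singleton.2 hw, rfl⟩)
  | cut _ _ ih₁ ih₂ =>
    intro x hx
    simp only [mem_interpList_append] at hx
    obtain ⟨_, ⟨a, ha, p, hp, rfl⟩, d, hd, rfl⟩ := hx
    refine ih₂ ?_
    simp only [mem_interpList_append, mem_interpList_singleton]
    exact ⟨_, ⟨a, ha, p, ih₁ hp, rfl⟩, d, hd, rfl⟩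

theorem mem_interp_lunder {l : List LForm} {B : LForm} {x : List α} :
    x ∈ interp v (lunder l B) ↔ ∀ w ∈ interpList v l, w ++ x ∈ interp v B := by
  induction l generalizing B with
  | nil => simp [interpList, lunder]
  | cons A l ih =>
    change x ∈ interp v (lunder l (ldiv A B)) ↔ _
    rw [ih]
    constructor
    · rintro h _ ⟨a, ha, b, hb, rfl⟩
      simpa using h b hb a ha
    · intro h b hb a ha
      simpa using h (a ++ b) ⟨a, ha, b, hb, rfl⟩

end LForm

/-! ### The model of optional expansion rules -/

namespace Menu

open LForm

/-- The generators of the monoid of the model. -/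
inductive Gen (ι : Type*)
  | rule (r : ι × List ι)
  | term (A : ι)
  | fill
  | test (A : ι)
  | head (A : ι)
  | low (A : ι)
  | raise (A : ι)
  | raiseBase
  | ruleEnd (r : ι × List ι)

namespace Gen

variable {ι : Type*}

/-- The generators which occur in phrases. -/
inductive IsLetter : Gen ι → Prop
  | rule (r) : IsLetter (rule r)
  | term (A) : IsLetter (term A)
  | fill : IsLetter fill

/-- The generators which end the words of the base type. -/
inductive IsEnd : Gen ι → Prop
  | head (A) : IsEnd (head A)
  | low (A) : IsEnd (low A)

end Gen

open Gen

/-! ### Words of the model -/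

section Words

variable {ι : Type*}

/-- Expansion of lists of symbols to words over the generators; rules may be skipped. -/
inductive Expands : List ι → List (Gen ι) → Prop
  | nil : Expands [] []
  | term {A : ι} {Θ : List ι} {w : List (Gen ι)} : Expands Θ w → Expands (A :: Θ) (term A :: w)
  | fill {A : ι} {Θ : List ι} {w : List (Gen ι)} : Expands Θ w → Expands (A :: Θ) (fill :: w)
  | rule {r : ι × List ι} {Θ : List ι} {w : List (Gen ι)} :
      Expands (r.2 ++ Θ) w → Expands (r.1 :: Θ) (rule r :: w)
  | skip {g : Gen ι} {A : ι} {Θ : List ι} {w : List (Gen ι)} : g = fill ∨ (∃ r, g = rule r) →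
      Expands (A :: Θ) w → Expands (A :: Θ) (g :: w)

theorem Expands.append {Θ Θ' : List ι} {u w : List (Gen ι)} (h : Expands Θ u)
    (h' : Expands Θ' w) : Expands (Θ ++ Θ') (u ++ w) := by
  induction h with
  | nil => exact h'
  | term _ ih => exact .term ih
  | fill _ ih => exact .fill ih
  | rule _ ih => exact .rule (by simpa using ih)
  | skip hg _ ih => exact .skip hg ih

theorem Expands.isLetter {Θ : List ι} {w : List (Gen ι)} (h : Expands Θ w) :
    ∀ g ∈ w, g.IsLetter := by
  induction h with
  | nil => simp
  | term _ ih => simpa using ⟨.term _, ih⟩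
  | fill _ ih => simpa using ⟨.fill, ih⟩
  | rule _ ih => simpa using ⟨.rule _, ih⟩
  | skip hg _ ih =>
    rcases hg with rfl | ⟨r, rfl⟩
    · simpa using ⟨.fill, ih⟩
    · simpa using ⟨.rule _, ih⟩

/-- The words of the type `lower A`. -/
inductive LowWord (A : ι) : List (Gen ι) → Prop
  | mk (v : List (Gen ι)) : (∀ g ∈ v, g.IsLetter ∨ g = test A) → LowWord A (v ++ [low A])

/-- The words of the type `base`. -/
inductive BaseWord : List (Gen ι) → Prop
  | head {A : ι} {u : List (Gen ι)} : Expands [A] u → BaseWord (u ++ [head A])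
  | low {A : ι} {x : List (Gen ι)} : LowWord A x → BaseWord x

/-- The words of the type `cont A`. -/
def ContWord (A : ι) (x : List (Gen ι)) : Prop := LowWord A x ∨ x = [head A]

/-- The words of the atom `raising`. -/
inductive RaisingWord : List (Gen ι) → Prop
  | base {x : List (Gen ι)} : BaseWord x → RaisingWord (x ++ [raiseBase])
  | head (A : ι) : RaisingWord ([head A] ++ [raiseBase])
  | cont {A : ι} {x : List (Gen ι)} : ContWord A x → RaisingWord (x ++ [raise A])

/-- The words of the type `choice r`. -/
inductive ChoiceWord (r : ι × List ι) : List (Gen ι) → Prop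
  | base {x : List (Gen ι)} : BaseWord x → ChoiceWord r x
  | product {u x : List (Gen ι)} : Expands r.2 u → ContWord r.1 x → ChoiceWord r (u ++ x)

/-- A word with a single end symbol, at its end. -/
def Ended (x : List (Gen ι)) : Prop :=
  ∃ v g, x = v ++ [g] ∧ g.IsEnd ∧ ∀ h ∈ v, ¬ h.IsEnd

theorem Gen.IsLetter.not_isEnd {g : Gen ι} (h : g.IsLetter) : ¬ g.IsEnd := by
  rcases h with _ | _ | _ <;> rintro ⟨⟩

theorem LowWord.ended {A : ι} {x : List (Gen ι)} (h : LowWord A x) : Ended x := by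
  obtain ⟨v, hv⟩ := h
  refine ⟨v, _, rfl, .low A, fun g hg => ?_⟩
  rcases hv g hg with h | rfl
  · exact h.not_isEnd
  · rintro ⟨⟩

theorem BaseWord.ended {x : List (Gen ι)} (h : BaseWord x) : Ended x := by
  rcases h with ⟨hu⟩ | h
  · exact ⟨_, _, rfl, .head _, fun g hg => (hu.isLetter g hg).not_isEnd⟩
  · exact h.ended

theorem ContWord.ended {A : ι} {x : List (Gen ι)} (h : ContWord A x) : Ended x := by
  rcases h with h | rfl
  · exact h.ended
  · exact ⟨[], _, rfl, .head _, by simp⟩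

theorem ChoiceWord.ended {r : ι × List ι} {x : List (Gen ι)} (h : ChoiceWord r x) :
    Ended x := by
  rcases h with h | @⟨u, _, hu, hx⟩
  · exact h.ended
  · obtain ⟨v, g, rfl, hg, hv⟩ := hx.ended
    refine ⟨u ++ v, g, by simp, hg, fun h hh => ?_⟩
    rcases List.mem_append.1 hh with h1 | h1
    · exact (hu.isLetter h h1).not_isEnd
    · exact hv h h1

theorem Ended.eq_nil {x t : List (Gen ι)} {g : Gen ι} (h : Ended (x ++ g :: t))
    (hg : g.IsEnd) : t = [] := by
  obtain ⟨v, g', he, -, hv⟩ := h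
  rcases List.eq_nil_or_concat t with rfl | ⟨t', g'', rfl⟩
  · rfl
  · have : x ++ g :: t' = v := by
      have h1 : (x ++ g :: t') ++ [g''] = v ++ [g'] := by simpa using he
      exact (List.append_inj' h1 rfl).1
    exact absurd hg (hv g (by simp [← this]))

theorem append_singleton_inj {α : Type*} {x y : List α} {g h : α} :
    x ++ [g] = y ++ [h] ↔ x = y ∧ g = h := by
  constructor
  · intro e
    obtain ⟨h1, h2⟩ := List.append_inj' e rfl
    exact ⟨h1, by simpa using h2⟩
  · rintro ⟨rfl, rfl⟩
    rfl

/-- If a word continues a word with an end symbol, and its last symbol follows a word with a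
single end symbol, then the continuation is this last symbol. -/
theorem Ended.eq_of_append {a b c : List (Gen ι)} {e g : Gen ι} (hb : Ended b)
    (he : e.IsEnd) (hg : ¬ g.IsEnd) (h : (a ++ [e]) ++ c = b ++ [g]) :
    b = a ++ [e] ∧ c = [g] := by
  rcases List.eq_nil_or_concat c with rfl | ⟨c', g', rfl⟩
  · obtain ⟨-, rfl⟩ := append_singleton_inj.1 (by simpa using h : a ++ [e] = b ++ [g])
    exact absurd he hg
  · obtain ⟨h1, rfl⟩ := append_singleton_inj.1
      (by simpa using h : (a ++ e :: c') ++ [g'] = b ++ [g])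
    subst h1
    obtain rfl := hb.eq_nil he
    simp

theorem baseWord_head {A : ι} {u : List (Gen ι)} (h : BaseWord (u ++ [head A])) :
    Expands [A] u := by
  generalize hx : u ++ [head A] = x at h
  rcases h with ⟨h⟩ | ⟨⟨v, hv⟩⟩
  · obtain ⟨rfl, h2⟩ := append_singleton_inj.1 hx
    cases h2
    exact h
  · have := (append_singleton_inj.1 hx).2
    cases this

theorem baseWord_low {A : ι} {v : List (Gen ι)} (h : BaseWord (v ++ [low A])) :
    LowWord A (v ++ [low A]) := by
  generalize hx : v ++ [low A] = x at h
  rcases h with ⟨h⟩ | ⟨h⟩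
  · have := (append_singleton_inj.1 hx).2
    cases this
  · obtain ⟨v', hv⟩ := h
    obtain ⟨rfl, h2⟩ := append_singleton_inj.1 hx
    cases h2
    exact ⟨_, hv⟩

theorem LowWord.forall_mem {A : ι} {v : List (Gen ι)} (h : LowWord A (v ++ [low A])) :
    ∀ g ∈ v, g.IsLetter ∨ g = test A := by
  generalize hx : v ++ [low A] = x at h
  obtain ⟨v', hv⟩ := h
  obtain ⟨rfl, -⟩ := append_singleton_inj.1 hx
  exact hv

theorem LowWord.letters_append {A : ι} {u x : List (Gen ι)} (h : LowWord A x)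
    (hu : ∀ g ∈ u, g.IsLetter) : LowWord A (u ++ x) := by
  obtain ⟨v, hv⟩ := h
  rw [← List.append_assoc]
  refine ⟨_, fun g hg => ?_⟩
  rcases List.mem_append.1 hg with h | h
  · exact .inl (hu g h)
  · exact hv g h

theorem BaseWord.cons {x : List (Gen ι)} {g : Gen ι} (h : BaseWord x)
    (hg : g = fill ∨ ∃ r, g = Gen.rule r) : BaseWord (g :: x) := by
  rcases h with ⟨h⟩ | ⟨h⟩
  · exact BaseWord.head (.skip hg h)
  · refine .low (h.letters_append (u := [g]) ?_)
    rcases hg with rfl | ⟨r, rfl⟩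
    · simpa using .fill
    · simpa using .rule r

end Words

/-! ### Interpretation of the types in the model -/

variable {ι : Type*} [Encodable ι]

/-- The languages of the atoms. -/
def atomWords (ι : Type*) [Encodable ι] (n : ℕ) : Set (List (Gen ι)) :=
  {x | (n = 0 ∧ BaseWord x) ∨ (n = 1 ∧ RaisingWord x) ∨
    (∃ A : ι, n = 2 * Encodable.encode A + 2 ∧ ∀ g ∈ x, g = test A) ∨
    ∃ r : ι × List ι, n = 2 * Encodable.encode r + 3 ∧ ∃ y, ChoiceWord r y ∧ x = y ++ [ruleEnd r]}

theorem mem_base {x : List (Gen ι)} : x ∈ interp (atomWords ι) base ↔ BaseWord x := by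
  simp [interp, base, atomWords]

theorem mem_raising {x : List (Gen ι)} :
    x ∈ interp (atomWords ι) raising ↔ RaisingWord x := by
  simp [interp, raising, atomWords]

theorem mem_mark {A : ι} {x : List (Gen ι)} :
    x ∈ interp (atomWords ι) (mark A) ↔ ∀ g ∈ x, g = test A := by
  have h (m n : ℕ) : 2 * m + 2 ≠ 2 * n + 3 := by omega
  simp only [interp, mark, atomWords, h]
  simp

theorem mem_ruleAtom {r : ι × List ι} {x : List (Gen ι)} :
    x ∈ interp (atomWords ι) (ruleAtom r) ↔ ∃ y, ChoiceWord r y ∧ x = y ++ [ruleEnd r] := by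
  have h (m n : ℕ) : 2 * m + 3 ≠ 2 * n + 2 := by omega
  simp only [interp, ruleAtom, atomWords, h]
  simp

theorem mem_rdiv_mark {A : ι} {x : List (Gen ι)} :
    x ∈ interp (atomWords ι) (rdiv (mark A) (mark A)) ↔ ∀ g ∈ x, g = test A := by
  constructor
  · intro h
    have := h [] (mem_mark.2 (by simp))
    rw [List.append_nil, mem_mark] at this
    exact this
  · intro h w hw
    rw [mem_mark] at hw ⊢
    intro g hg
    rcases List.mem_append.1 hg with h1 | h1
    · exact h g h1
    · exact hw g h1

/-- Membership is tested with the prefixes `[]` and `[test A]`. Expansions contain no `test` symbol,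
and a word ending in `low B` tolerates only `test B`, so just the words ending in `low A` survive.
-/
theorem mem_lower {A : ι} {x : List (Gen ι)} :
    x ∈ interp (atomWords ι) (lower A) ↔ LowWord A x := by
  constructor
  · intro h
    have h1 := mem_base.1 (h [test A] (mem_rdiv_mark.2 (by simp)))
    have h0 := mem_base.1 (h [] (mem_rdiv_mark.2 (by simp)))
    simp only [List.nil_append, List.singleton_append] at h0 h1
    rcases h0 with ⟨h0⟩ | ⟨⟨v, hv⟩⟩
    · have := (baseWord_head (u := test A :: _) h1).isLetter (test A) (by simp)
      cases this
    · have := (baseWord_low (v := test A :: v) h1).forall_mem (test A) (by simp)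
      rcases this with h | h
      · cases h
      · cases h
        exact ⟨v, hv⟩
  · rintro ⟨v, hv⟩ w hw
    rw [mem_rdiv_mark] at hw
    rw [mem_base, ← List.append_assoc]
    refine .low ⟨_, fun g hg => ?_⟩
    rcases List.mem_append.1 hg with h | h
    · exact .inr (hw g h)
    · exact hv g h

/-- Applying a word to `[raise A]` bounds the interpretation from above. For `[head A]`, testing a
continuation on `[low A]` shows that it is `[raise A]` or `[raiseBase]`; the `head` clause of
`RaisingWord` exists for the second case. -/
theorem mem_cont {A : ι} {x : List (Gen ι)} :
    x ∈ interp (atomWords ι) (cont A) ↔ ContWord A x := by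
  constructor
  · intro h
    have h1 : [raise A] ∈ interp (atomWords ι) (ldiv (lower A) raising) := by
      intro w hw
      exact mem_raising.2 (.cont (.inl (mem_lower.1 hw)))
    have h2 := mem_raising.1 (h _ h1)
    generalize hy : x ++ [raise A] = y at h2
    rcases h2 with h2 | B | h2
    · cases (append_singleton_inj.1 hy).2
    · cases (append_singleton_inj.1 hy).2
    · obtain ⟨rfl, h3⟩ := append_singleton_inj.1 hy
      cases h3
      exact h2
  · rintro (h | rfl)
    · exact (lower_cont A).interpList_subset (mem_interpList_singleton.2 (mem_lower.2 h))
    · intro w hw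
      have h1 := mem_raising.1 (hw [low A] (mem_lower.2 (.mk [] (by simp))))
      generalize hy : [low A] ++ w = y at h1
      rcases h1 with h1 | B | @⟨B, _, h1⟩
      · obtain ⟨-, rfl⟩ := h1.ended.eq_of_append (a := []) (.low A) (by rintro ⟨⟩) hy
        exact mem_raising.2 (.head A)
      · cases (Ended.eq_of_append (a := []) ⟨[], _, rfl, .head B, by simp⟩ (.low A)
          (by rintro ⟨⟩) hy).1
      · obtain ⟨rfl, rfl⟩ := h1.ended.eq_of_append (a := []) (.low A) (by rintro ⟨⟩) hy
        have : A = B := by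
          rcases h1 with h1 | h1
          · generalize hz : [] ++ [low A] = z at h1
            obtain ⟨v, -⟩ := h1
            cases (append_singleton_inj.1 hz).2
            rfl
          · cases h1
        subst this
        exact mem_raising.2 (.cont (.inr rfl))

/-- The word `[head A]` of `cont A` records the kind of the phrase, so a single test recovers the
expansion. -/
theorem mem_phrase {A : ι} {x : List (Gen ι)} :
    x ∈ interp (atomWords ι) (phrase A) ↔ Expands [A] x := by
  constructor
  · intro h
    exact baseWord_head (mem_base.1 (h [head A] (mem_cont.2 (.inr rfl))))
  · intro h w hw
    rw [mem_base]
    rcases mem_cont.1 hw with h1 | rfl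
    · exact .low (h1.letters_append h.isLetter)
    · exact .head h

/-- Testing with `[raiseBase]` shows that words of `upper` are base words or single symbols `head
B`. Accordingly `fill` must be skippable in an expansion and must also be able to stand for a whole
symbol. -/
theorem fill_mem_filler : [fill] ∈ interp (atomWords ι) filler := by
  intro x hx
  have h1 : [raiseBase] ∈ interp (atomWords ι) (ldiv base raising) := by
    intro w hw
    exact mem_raising.2 (.base (mem_base.1 hw))
  have h2 := mem_raising.1 (hx _ h1)
  rw [mem_base]
  generalize hy : x ++ [raiseBase] = y at h2
  rcases h2 with h2 | B | h2
  · obtain ⟨rfl, -⟩ := append_singleton_inj.1 hy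
    exact h2.cons (.inl rfl)
  · obtain ⟨rfl, -⟩ := append_singleton_inj.1 hy
    exact BaseWord.head (.fill .nil)
  · cases (append_singleton_inj.1 hy).2

theorem expands_of_mem_phrases {Θ : List ι} {x : List (Gen ι)}
    (h : x ∈ interpList (atomWords ι) (Θ.map phrase)) : Expands Θ x := by
  induction Θ generalizing x with
  | nil =>
    obtain rfl : x = [] := h
    exact .nil
  | cons A Θ ih =>
    obtain ⟨a, ha, b, hb, rfl⟩ := h
    exact (mem_phrase.1 ha).append (ih hb)

theorem ruleEnd_mem_skipArg (r : ι × List ι) :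
    [ruleEnd r] ∈ interp (atomWords ι) (skipArg r) := by
  intro w hw
  exact mem_ruleAtom.2 ⟨w, .base (mem_base.1 hw), rfl⟩

theorem ruleEnd_mem_useArg (r : ι × List ι) :
    [ruleEnd r] ∈ interp (atomWords ι) (useArg r) := by
  rw [useArg, mem_interp_lunder]
  intro w hw
  obtain ⟨a, ha, b, hb, rfl⟩ := mem_interpList_append.1 hw
  rw [mem_interpList_singleton] at hb
  exact mem_ruleAtom.2 ⟨_, .product (expands_of_mem_phrases ha) (mem_cont.1 hb), rfl⟩

/-- The test word `fill … fill low` has its only end symbol in last position, so the continuation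
can be nothing but `ruleEnd r`. -/
theorem mem_bound {r : ι × List ι} {x : List (Gen ι)} :
    x ∈ interp (atomWords ι) (bound r) ↔ x = [ruleEnd r] := by
  constructor
  · intro h
    rw [bound, mem_interp_lunder] at h
    have h1 : r.2.map (fun _ => fill) ∈
        interpList (atomWords ι) (r.2.map (fun _ => filler)) := by
      induction r.2 with
      | nil => rfl
      | cons A l ih => exact ⟨_, fill_mem_filler, _, ih, rfl⟩
    have h2 := h _ (mem_interpList_append.2 ⟨_, h1, [low r.1],
      mem_interpList_singleton.2 (mem_lower.2 (.mk [] (by simp))), rfl⟩)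
    obtain ⟨y, hy, he⟩ := mem_ruleAtom.1 h2
    exact (hy.ended.eq_of_append (.low r.1) (by rintro ⟨⟩) he).2
  · rintro rfl
    exact (skipArg_bound r).interpList_subset
      (mem_interpList_singleton.2 (ruleEnd_mem_skipArg r))

/-- Because `bound r` denotes a single word lying in both `skipArg r` and `useArg r`, the outer
factors of `meet r` contain the empty word and `meet r` contains `[ruleEnd r]`. -/
theorem choiceWord_of_mem {r : ι × List ι} {x : List (Gen ι)}
    (h : x ∈ interp (atomWords ι) (choice r)) : ChoiceWord r x := by
  have h1 : [] ∈ interp (atomWords ι) (rdiv (skipArg r) (bound r)) := by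
    intro w hw
    obtain rfl := mem_bound.1 hw
    exact ruleEnd_mem_skipArg r
  have h2 : [] ∈ interp (atomWords ι) (ldiv (bound r) (useArg r)) := by
    intro w hw
    obtain rfl := mem_bound.1 hw
    exact ruleEnd_mem_useArg r
  have h3 := h _ h1 _ (mem_bound.2 rfl) _ h2
  obtain ⟨y, hy, he⟩ := mem_ruleAtom.1 h3
  obtain ⟨rfl, -⟩ := append_singleton_inj.1 (by simpa using he : x ++ [ruleEnd r] = y ++ [ruleEnd r])
  exact hy

theorem rule_mem_option (r : ι × List ι) :
    [Gen.rule r] ∈ interp (atomWords ι) (option r) := by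
  intro x hx
  rw [mem_base]
  rcases choiceWord_of_mem hx with h | ⟨hu, h⟩
  · exact h.cons (.inr ⟨r, rfl⟩)
  · rcases h with h | rfl
    · rw [← List.append_assoc]
      refine .low (h.letters_append fun g hg => ?_)
      rcases List.mem_cons.1 hg with rfl | hg
      · exact .rule r
      · exact hu.isLetter g hg
    · exact BaseWord.head (u := Gen.rule r :: _) (.rule (by simpa using hu))

/-- The word of a letter preceded by optional rules. -/
def letterWord (bl : List (ι × List ι)) (A : ι) : List (Gen ι) := bl.map Gen.rule ++ [term A]

theorem letterWord_mem_letter (bl : List (ι × List ι)) (A : ι) :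
    letterWord bl A ∈ interp (atomWords ι) (letter bl A) := by
  intro x hx
  refine mem_interp_lunder.1 hx _ (mem_interpList_append.2 ⟨_, ?_, _,
    mem_interpList_singleton.2 (mem_phrase.2 (.term .nil)), rfl⟩)
  clear hx
  induction bl with
  | nil => rfl
  | cons r bl ih => exact ⟨_, rule_mem_option r, _, ih, rfl⟩

theorem expands_of_lder {bl : List (ι × List ι)} {w : List ι} {A : ι}
    (h : LDer (w.map (letter bl)) (phrase A)) :
    Expands [A] (w.flatMap (letterWord bl)) := by
  refine mem_phrase.1 (h.interpList_subset ?_)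
  clear h
  induction w with
  | nil => rfl
  | cons B w ih => exact ⟨_, letterWord_mem_letter bl B, _, ih, rfl⟩

end Menu

/-! ### Chains without repetitions -/

namespace Relation.ReflTransGen

/-- Two related elements are connected by a chain without repetitions. -/
theorem exists_nodup_chain {α : Type*} {r : α → α → Prop} {a b : α}
    (h : Relation.ReflTransGen r a b) :
    ∃ l : List α, (a :: l).IsChain r ∧ (a :: l).getLast (by simp) = b ∧ (a :: l).Nodup := by
  induction h using Relation.ReflTransGen.head_induction_on with
  | refl => exact ⟨[], by simp⟩
  | @head a c hac _ ih =>
    obtain ⟨l, hl, hb, hn⟩ := ih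
    by_cases ha : a ∈ c :: l
    · obtain ⟨s, t, hst⟩ := List.append_of_mem ha
      simp only [hst] at hl hb hn
      refine ⟨t, hl.right_of_append, ?_, (List.nodup_append.1 hn).2.1⟩
      rw [← hb, List.getLast_append_of_right_ne_nil]
    · exact ⟨c :: l, by simpa using ⟨hac, hl⟩, by simpa using hb, List.nodup_cons.2 ⟨ha, hn⟩⟩

end Relation.ReflTransGen

namespace CFGData

variable {T : Type*} {N : Type} {G : CFGData T N}

/-! ### Words derived from strings of symbols -/

/-- `G.Yields γ w`: the word `w` is derived from the string of symbols `γ`. -/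
inductive Yields (G : CFGData T N) : List (Symbol T N) → List T → Prop
  | nil : G.Yields [] []
  | terminal (a : T) {γ : List (Symbol T N)} {w : List T} : G.Yields γ w →
      G.Yields (.terminal a :: γ) (a :: w)
  | nonterminal {r : ContextFreeRule T N} {γ : List (Symbol T N)} {u w : List T} :
      r ∈ G.rules → G.Yields r.output u → G.Yields γ w →
      G.Yields (.nonterminal r.input :: γ) (u ++ w)

theorem mem_toGrammar_rules {r : ContextFreeRule T N} :
    r ∈ G.toGrammar.rules ↔ r ∈ G.rules := by
  classical
  exact List.mem_toFinset

namespace Yields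

theorem append {γ δ : List (Symbol T N)} {u w : List T} (h : G.Yields γ u)
    (h' : G.Yields δ w) : G.Yields (γ ++ δ) (u ++ w) := by
  induction h with
  | nil => exact h'
  | terminal a _ ih => exact .terminal a ih
  | nonterminal hr h₁ _ _ ih => simpa using Yields.nonterminal hr h₁ ih

theorem exists_of_append {γ δ : List (Symbol T N)} {w : List T} (h : G.Yields (γ ++ δ) w) :
    ∃ u v, G.Yields γ u ∧ G.Yields δ v ∧ w = u ++ v := by
  induction γ generalizing w with
  | nil => exact ⟨[], w, .nil, h, rfl⟩
  | cons X γ ih =>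
    rcases h with _ | ⟨a, h⟩ | ⟨hr, h₁, h⟩
    · obtain ⟨u, v, hu, hv, rfl⟩ := ih h
      exact ⟨a :: u, v, .terminal a hu, hv, rfl⟩
    · obtain ⟨u, v, hu, hv, rfl⟩ := ih h
      exact ⟨_ ++ u, v, .nonterminal hr h₁ hu, hv, by simp⟩

theorem single {r : ContextFreeRule T N} {w : List T} (hr : r ∈ G.rules)
    (h : G.Yields r.output w) : G.Yields [.nonterminal r.input] w := by
  simpa using Yields.nonterminal hr h .nil

theorem map_terminal (w : List T) : G.Yields (w.map Symbol.terminal) w := by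
  induction w with
  | nil => exact .nil
  | cons a w ih => exact .terminal a ih

theorem eq_nil {w : List T} (h : G.Yields [] w) : w = [] := by
  cases h
  rfl

theorem derives {γ : List (Symbol T N)} {w : List T} (h : G.Yields γ w) :
    G.toGrammar.Derives γ (w.map Symbol.terminal) := by
  induction h with
  | nil => exact .refl _
  | terminal a _ ih => exact ih.append_left [.terminal a]
  | @nonterminal r γ u w hr _ _ ih₁ ih₂ =>
    have h1 : G.toGrammar.Produces [Symbol.nonterminal r.input] r.output :=
      ⟨r, mem_toGrammar_rules.2 hr, ContextFreeRule.Rewrites.input_output⟩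
    have h2 := (h1.trans_derives ih₁).append_right γ
    have h3 := ih₂.append_left (u.map Symbol.terminal)
    rw [List.map_append]
    exact h2.trans h3

theorem of_derives {γ δ : List (Symbol T N)} (h : G.toGrammar.Derives γ δ) {w : List T}
    (hδ : G.Yields δ w) : G.Yields γ w := by
  induction h using Relation.ReflTransGen.head_induction_on with
  | refl => exact hδ
  | head hp _ ih =>
    obtain ⟨r, hr, hrw⟩ := hp
    obtain ⟨p, q, rfl, rfl⟩ := hrw.exists_parts
    obtain ⟨_, v, h, hv, rfl⟩ := exists_of_append ih
    obtain ⟨u, m, hu, hm, rfl⟩ := exists_of_append h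
    exact (hu.append (single (mem_toGrammar_rules.1 hr) hm)).append hv

end Yields

theorem mem_language_iff {w : List T} :
    w ∈ G.toGrammar.language ↔ G.Yields [.nonterminal G.start] w :=
  ⟨fun h => Yields.of_derives h (Yields.map_terminal w), Yields.derives⟩

theorem Yields.mem_alphabet (hG : G.WellFormed) {γ : List (Symbol T N)} {w : List T}
    (h : G.Yields γ w) (hγ : ∀ a, Symbol.terminal a ∈ γ → a ∈ G.alphabet) :
    ∀ a ∈ w, a ∈ G.alphabet := by
  induction h with
  | nil => simp
  | terminal b _ ih =>
    intro a ha
    rcases List.mem_cons.1 ha with rfl | ha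
    · exact hγ a (by simp)
    · exact ih (fun a ha => hγ a (by simp [ha])) a ha
  | nonterminal hr _ _ ih₁ ih₂ =>
    intro a ha
    rcases List.mem_append.1 ha with ha | ha
    · exact ih₁ (hG _ hr) a ha
    · exact ih₂ (fun a ha => hγ a (by simp [ha])) a ha

/-! ### The left-corner grammar -/

/-- The label `(β, X)` stands for the words which complete every word derived from `β`
to a word derived from `X`. -/
abbrev Label (T : Type*) (N : Type) := List (Symbol T N) × Symbol T N

/-- The non-terminals having a rule. -/
def inputs (G : CFGData T N) : List N := G.rules.map ContextFreeRule.input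

/-- The left contexts used in labels. -/
def contexts (G : CFGData T N) : List (List (Symbol T N)) :=
  [] :: G.inputs.map fun A => [.nonterminal A]

/-- The label of a symbol. -/
def symbolLabel (X : Symbol T N) : Label T N := ([], X)

/-- The phrase with a given left context is a phrase `D` with this context, and what follows
`D` as a left corner. -/
def cornerRules (G : CFGData T N) : List (Label T N × List (Label T N)) :=
  G.contexts.flatMap fun β => G.inputs.flatMap fun A => G.inputs.map fun D =>
    ((β, .nonterminal A), [(β, .nonterminal D), ([.nonterminal D], .nonterminal A)])

/-- Rules with the left context inside the first symbol. -/
def expandRules (G : CFGData T N) : List (Label T N × List (Label T N)) :=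
  G.contexts.flatMap fun β => G.rules.map fun r =>
    ((β, .nonterminal r.input),
      (r.output.take 1).map (fun X => (β, X)) ++ (r.output.drop 1).map symbolLabel)

/-- Rules with the first symbol as the left context. -/
def completeRules (G : CFGData T N) : List (Label T N × List (Label T N)) :=
  G.rules.map fun r => ((r.output.take 1, .nonterminal r.input), (r.output.drop 1).map symbolLabel)

/-- The rules of the left-corner grammar. -/
def leftCornerRules (G : CFGData T N) : List (Label T N × List (Label T N)) :=
  G.cornerRules ++ G.expandRules ++ G.completeRules

/-! ### Soundness of the left-corner grammar -/

/-- The words described by a label. -/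
def labelWords (G : CFGData T N) (ℓ : Label T N) : Set (List T) :=
  {w | ∀ u, G.Yields ℓ.1 u → G.Yields [ℓ.2] (u ++ w)}

/-- The words described by a list of labels. -/
def labelsWords (G : CFGData T N) : List (Label T N) → Set (List T)
  | [] => {[]}
  | ℓ :: Θ => {w | ∃ a ∈ G.labelWords ℓ, ∃ b ∈ G.labelsWords Θ, w = a ++ b}

theorem exists_of_mem_labelsWords_append {Θ Θ' : List (Label T N)} {w : List T}
    (h : w ∈ G.labelsWords (Θ ++ Θ')) :
    ∃ a ∈ G.labelsWords Θ, ∃ b ∈ G.labelsWords Θ', w = a ++ b := by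
  induction Θ generalizing w with
  | nil => exact ⟨[], rfl, w, h, rfl⟩
  | cons ℓ Θ ih =>
    obtain ⟨a, ha, b, hb, rfl⟩ := h
    obtain ⟨c, hc, d, hd, rfl⟩ := ih hb
    exact ⟨a ++ c, ⟨a, ha, c, hc, rfl⟩, d, hd, by simp⟩

theorem yields_of_mem_labelsWords {γ : List (Symbol T N)} {w : List T}
    (h : w ∈ G.labelsWords (γ.map symbolLabel)) : G.Yields γ w := by
  induction γ generalizing w with
  | nil =>
    obtain rfl : w = [] := h
    exact .nil
  | cons X γ ih =>
    obtain ⟨a, ha, b, hb, rfl⟩ := h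
    exact (ha [] .nil).append (ih hb)

/-- The absence of ε-rules matters for `expandRules`: with an empty right-hand side the left context
`β` would be lost. -/
theorem mem_labelWords_of_rule (hG : G.EpsilonFree) {r : Label T N × List (Label T N)}
    (hr : r ∈ G.leftCornerRules) {w : List T} (hw : w ∈ G.labelsWords r.2) :
    w ∈ G.labelWords r.1 := by
  simp only [leftCornerRules, List.mem_append] at hr
  rcases hr with (hr | hr) | hr
  · simp only [cornerRules, List.mem_flatMap, List.mem_map] at hr
    obtain ⟨β, -, A, -, D, -, rfl⟩ := hr
    obtain ⟨a, ha, _, ⟨b, hb, _, rfl, rfl⟩, rfl⟩ := hw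
    intro u hu
    simpa using hb _ (ha u hu)
  · simp only [expandRules, List.mem_flatMap, List.mem_map] at hr
    obtain ⟨β, -, r, hr, rfl⟩ := hr
    obtain ⟨X, γ, hX⟩ := List.exists_cons_of_ne_nil (hG r hr)
    simp only [hX, List.take_succ_cons, List.take_zero, List.drop_succ_cons, List.drop_zero,
      List.map_cons, List.map_nil] at hw
    obtain ⟨a, ha, b, hb, rfl⟩ := hw
    intro u hu
    refine Yields.single hr ?_
    rw [hX]
    simpa using (ha u hu).append (yields_of_mem_labelsWords hb)
  · simp only [completeRules, List.mem_map] at hr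
    obtain ⟨r, hr, rfl⟩ := hr
    intro u hu
    refine Yields.single hr ?_
    have := Yields.append (γ := r.output.take 1) hu (yields_of_mem_labelsWords hw)
    rwa [List.take_append_drop] at this

open Menu in
/-- `G.Reads x w`: the word `w` is read from the word `x` over the generators of the model. -/
inductive Reads (G : CFGData T N) : List (Gen (Label T N)) → List T → Prop
  | nil : G.Reads [] []
  | rule {r : Label T N × List (Label T N)} {x : List (Gen (Label T N))} {w : List T} :
      r ∈ G.leftCornerRules → G.Reads x w → G.Reads (.rule r :: x) w
  | term (a : T) {x : List (Gen (Label T N))} {w : List T} :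
      G.Reads x w → G.Reads (.term (symbolLabel (.terminal a)) :: x) (a :: w)

/-- Readable words contain no `fill`, so only genuine rules, skipped rules and terminals remain;
skipping a rule does not change the word read. -/
theorem Reads.mem_labelsWords (hG : G.EpsilonFree) {Θ : List (Label T N)}
    {x : List (Menu.Gen (Label T N))} (hx : Menu.Expands Θ x) {w : List T} (h : G.Reads x w) :
    w ∈ G.labelsWords Θ := by
  induction hx generalizing w with
  | nil =>
    cases h
    rfl
  | term _ ih =>
    rcases h with _ | _ | ⟨a, h⟩
    refine ⟨[a], fun u hu => ?_, _, ih h, rfl⟩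
    obtain rfl := hu.eq_nil
    exact .terminal a .nil
  | fill => cases h
  | rule _ ih =>
    rcases h with _ | ⟨hr, h⟩
    obtain ⟨a, ha, b, hb, rfl⟩ := exists_of_mem_labelsWords_append (ih h)
    exact ⟨a, mem_labelWords_of_rule hG hr ha, b, hb, rfl⟩
  | skip hg _ ih =>
    rcases hg with rfl | ⟨r, rfl⟩
    · cases h
    · rcases h with _ | ⟨-, h⟩
      exact ih h

theorem Reads.rules {bl : List (Label T N × List (Label T N))}
    (hbl : ∀ r ∈ bl, r ∈ G.leftCornerRules) {x : List (Menu.Gen (Label T N))} {w : List T}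
    (h : G.Reads x w) : G.Reads (bl.map Menu.Gen.rule ++ x) w := by
  induction bl with
  | nil => exact h
  | cons r bl ih => exact .rule (hbl r (by simp)) (ih fun r hr => hbl r (by simp [hr]))

theorem reads_letterWord {bl : List (Label T N × List (Label T N))}
    (h : ∀ r ∈ bl, r ∈ G.leftCornerRules) (w : List T) :
    G.Reads ((w.map fun a => symbolLabel (.terminal a)).flatMap (Menu.letterWord bl)) w := by
  induction w with
  | nil => exact .nil
  | cons a w ih =>
    rw [List.map_cons, List.flatMap_cons, Menu.letterWord, List.append_assoc]
    exact (Reads.term a ih).rules h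

/-! ### Completeness of the left-corner grammar -/

/-- Unit productions. -/
def UnitStep (G : CFGData T N) (A B : N) : Prop :=
  ∃ r ∈ G.rules, r.input = A ∧ r.output = [.nonterminal B]

/-- A bound for the number of expansion steps per letter. -/
def stepBound (G : CFGData T N) : ℕ := 2 * G.rules.length + 4

/-- Expansion by the left-corner grammar. -/
abbrev Expandable (G : CFGData T N) (k : ℕ) (Θ w : List (Label T N)) : Prop :=
  Menu.Accepts G.leftCornerRules G.stepBound k Θ w

theorem mem_inputs {r : ContextFreeRule T N} (hr : r ∈ G.rules) : r.input ∈ G.inputs :=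
  List.mem_map_of_mem hr

theorem nil_mem_contexts : [] ∈ G.contexts := by simp [contexts]

theorem mem_contexts {A : N} (hA : A ∈ G.inputs) : [.nonterminal A] ∈ G.contexts := by
  simpa [contexts] using hA

theorem UnitStep.mem_inputs {A B : N} (h : G.UnitStep A B) : A ∈ G.inputs := by
  obtain ⟨r, hr, rfl, -⟩ := h
  exact CFGData.mem_inputs hr

namespace Expandable

theorem corner {k : ℕ} {β : List (Symbol T N)} {A D : N} {Θ w : List (Label T N)}
    (hβ : β ∈ G.contexts) (hA : A ∈ G.inputs) (hD : D ∈ G.inputs)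
    (h : G.Expandable k ((β, .nonterminal D) :: ([.nonterminal D], .nonterminal A) :: Θ) w) :
    G.Expandable (k + 1) ((β, .nonterminal A) :: Θ) w := by
  refine Menu.Accepts.step (B := ((β, Symbol.nonterminal D) : Label T N))
    (l := [([Symbol.nonterminal D], Symbol.nonterminal A)]) ?_ h
  simp only [leftCornerRules, cornerRules, List.mem_append, List.mem_flatMap, List.mem_map]
  exact .inl (.inl ⟨β, hβ, A, hA, D, hD, rfl⟩)

theorem expand {k : ℕ} {β γ : List (Symbol T N)} {X : Symbol T N} {r : ContextFreeRule T N}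
    {Θ w : List (Label T N)} (hβ : β ∈ G.contexts) (hr : r ∈ G.rules) (hX : r.output = X :: γ)
    (h : G.Expandable k ((β, X) :: (γ.map symbolLabel ++ Θ)) w) :
    G.Expandable (k + 1) ((β, .nonterminal r.input) :: Θ) w := by
  refine .step (l := γ.map symbolLabel) ?_ h
  simp only [leftCornerRules, expandRules, List.mem_append, List.mem_flatMap, List.mem_map]
  exact .inl (.inr ⟨β, hβ, r, hr, by simp [hX]⟩)

theorem complete {k : ℕ} {γ : List (Symbol T N)} {X : Symbol T N} {r : ContextFreeRule T N}
    {Θ w : List (Label T N)} (hr : r ∈ G.rules) (hX : r.output = X :: γ) (hγ : γ ≠ [])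
    (h : G.Expandable k (γ.map symbolLabel ++ Θ) w) :
    G.Expandable (k + 1) (([X], .nonterminal r.input) :: Θ) w := by
  obtain ⟨Y, δ, rfl⟩ := List.exists_cons_of_ne_nil hγ
  refine .step (l := δ.map symbolLabel) ?_ h
  simp only [leftCornerRules, completeRules, List.mem_append, List.mem_map]
  exact .inr ⟨r, hr, by simp [hX]⟩

theorem chain {k : ℕ} {β : List (Symbol T N)} {Θ w : List (Label T N)} (hβ : β ∈ G.contexts)
    {l : List N} {E : N} (hl : (E :: l).IsChain G.UnitStep)
    (h : G.Expandable k ((β, .nonterminal ((E :: l).getLast (by simp))) :: Θ) w) :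
    G.Expandable (k + l.length) ((β, .nonterminal E) :: Θ) w := by
  induction l generalizing E with
  | nil => exact h
  | cons A l ih =>
    rw [List.isChain_cons_cons] at hl
    obtain ⟨⟨r, hr, rfl, hA⟩, hl⟩ := hl
    exact expand hβ hr hA (ih hl (by simpa using h))

/-- Every member of the chain except the last is the left-hand side of a rule, and these members are
distinct. -/
theorem _root_.CFGData.length_le_of_isChain {l : List N} {E : N}
    (hl : (E :: l).IsChain G.UnitStep) (hn : (E :: l).Nodup) : l.length ≤ G.rules.length := by
  have hsub : (E :: l).dropLast ⊆ G.inputs := by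
    clear hn
    induction l generalizing E with
    | nil => simp
    | cons A l ih =>
      rw [List.isChain_cons_cons] at hl
      have := ih hl.2
      intro x hx
      rw [List.dropLast_cons_of_ne_nil (by simp), List.mem_cons] at hx
      rcases hx with rfl | hx
      · exact hl.1.mem_inputs
      · exact this hx
  have hnd : (E :: l).dropLast.Nodup := hn.sublist (List.dropLast_sublist _)
  simpa [inputs] using (List.subperm_of_subset hnd hsub).length_le

theorem unit {k : ℕ} {β : List (Symbol T N)} {Θ w : List (Label T N)} (hβ : β ∈ G.contexts)
    {E D : N} (hED : Relation.ReflTransGen G.UnitStep E D)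
    (h : G.Expandable k ((β, .nonterminal D) :: Θ) w) :
    G.Expandable (k + G.rules.length) ((β, .nonterminal E) :: Θ) w := by
  obtain ⟨l, hl, rfl, hn⟩ := hED.exists_nodup_chain
  exact (chain hβ hl h).mono (by have := length_le_of_isChain hl hn; omega)

end Expandable

/-- The second part climbs a leftmost branch: `E` is the top of a run of unit steps ending at the
node expanded to `γ`, and `A` is a goal to be completed from its left corner `E`. Carrying `E`
instead of `r.input` postpones unit steps until a whole run can be replaced by a short chain. Before
the first letter one corner step, one unit chain and one expansion suffice, whence `|rules| + 2`;
after each letter the budget is `stepBound` again. -/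
theorem expandable_of_yields (hG : G.EpsilonFree) {γ : List (Symbol T N)} {u : List T}
    (h : G.Yields γ u) :
    (γ ≠ [] → ∀ Θ w, G.Expandable G.stepBound Θ w →
      G.Expandable (G.rules.length + 2) (γ.map symbolLabel ++ Θ)
        (u.map (fun a => symbolLabel (.terminal a)) ++ w)) ∧
    ∀ r ∈ G.rules, r.output = γ → ∀ E, Relation.ReflTransGen G.UnitStep E r.input →
      (∀ A ∈ G.inputs, ∀ Θ w,
        G.Expandable G.stepBound (([.nonterminal E], .nonterminal A) :: Θ) w →
        G.Expandable (G.rules.length + 2) (([], .nonterminal A) :: Θ)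
          (u.map (fun a => symbolLabel (.terminal a)) ++ w)) ∧
      ∀ Θ w, G.Expandable G.stepBound Θ w →
        G.Expandable (G.rules.length + 2) (([], .nonterminal E) :: Θ)
          (u.map (fun a => symbolLabel (.terminal a)) ++ w) := by
  have hE {E : N} {r : ContextFreeRule T N} (hr : r ∈ G.rules)
      (h : Relation.ReflTransGen G.UnitStep E r.input) : E ∈ G.inputs := by
    rcases h.cases_head with rfl | ⟨B, hB, -⟩
    · exact mem_inputs hr
    · exact hB.mem_inputs
  have hK : G.rules.length + 2 ≤ G.stepBound := by unfold stepBound; omega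
  induction h with
  | nil => exact ⟨fun h => absurd rfl h, fun r hr h => absurd h (hG r hr)⟩
  | @terminal a γ u _ ih =>
    have key : ∀ Θ w, G.Expandable G.stepBound Θ w → ∀ k,
        G.Expandable k (symbolLabel (.terminal a) :: (γ.map symbolLabel ++ Θ))
          (symbolLabel (.terminal a) :: (u.map (fun a => symbolLabel (.terminal a)) ++ w)) := by
      intro Θ w h k
      refine .shift k ?_
      by_cases hγ : γ = []
      · subst hγ
        obtain rfl := Yields.eq_nil ‹_›
        exact h
      · exact (ih.1 hγ Θ w h).mono hK
    refine ⟨fun _ Θ w h => key Θ w h _, fun r hr hout E hED => ⟨fun A hA Θ w h => ?_,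
      fun Θ w h => ?_⟩⟩
    · refine (Expandable.corner nil_mem_contexts hA (hE hr hED)
        (Expandable.unit nil_mem_contexts hED
          (Expandable.expand nil_mem_contexts hr hout (key _ w h 0)))).mono ?_
      omega
    · refine (Expandable.unit nil_mem_contexts hED
        (Expandable.expand nil_mem_contexts hr hout (key _ w h 0))).mono ?_
      omega
  | @nonterminal r γ u v hr _ hv ih₁ ih₂ =>
    have hB := mem_inputs hr
    refine ⟨fun _ Θ w h => ?_, fun r' hr' hout E hED => ?_⟩
    · rw [List.map_append, List.append_assoc]
      refine ((ih₁.2 r hr rfl r.input .refl).2 _ _ ?_)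
      by_cases hγ : γ = []
      · subst hγ
        obtain rfl := hv.eq_nil
        exact h
      · exact (ih₂.1 hγ Θ w h).mono hK
    -- If nothing follows the left corner, `r'` is a unit production and just prolongs the run below
    -- `E`.
    · by_cases hγ : γ = []
      · subst hγ
        obtain rfl := hv.eq_nil
        rw [List.append_nil]
        exact ih₁.2 r hr rfl E (hED.tail ⟨r', hr', rfl, hout⟩)
      -- With the corner already read, the cost is a unit chain, one completion, and `|rules| + 2`
      -- steps to the first letter of what follows.
      · have key : ∀ Θ w, G.Expandable G.stepBound Θ w →
            G.Expandable (2 * G.rules.length + 3)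
              (([.nonterminal r.input], .nonterminal E) :: Θ)
              (v.map (fun a => symbolLabel (.terminal a)) ++ w) := by
          intro Θ w h
          refine (Expandable.unit (mem_contexts hB) hED
            (Expandable.complete hr' hout hγ (ih₂.1 hγ Θ w h))).mono ?_
          omega
        rw [List.map_append]
        refine ⟨fun A hA Θ w h => ?_, fun Θ w h => ?_⟩
        · rw [List.append_assoc]
          refine (ih₁.2 r hr rfl r.input .refl).1 A hA Θ _ ?_
          -- This extra corner step, making `E` a left corner of `A`, brings the count to exactly
          -- `stepBound`.
          exact Expandable.corner (mem_contexts hB) hA (hE hr' hED) (key _ w h)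
        · rw [List.append_assoc]
          refine (ih₁.2 r hr rfl r.input .refl).1 E (hE hr' hED) Θ _ ?_
          exact (key Θ w h).mono (by unfold stepBound; omega)

end CFGData

/-! ### Computability of the formulae -/

namespace LForm

theorem primrec_var : Primrec var :=
  Primrec.encode_iff.1 ((Primrec.nat_mul.comp (Primrec.const 3) Primrec.id).of_eq fun _ => rfl)

theorem primrec_ldiv : Primrec₂ ldiv :=
  Primrec₂.encode_iff.1 ((Primrec.succ.comp (Primrec.nat_mul.comp (Primrec.const 3)
    (Primrec₂.natPair.comp (Primrec.encode.comp Primrec.fst)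
      (Primrec.encode.comp Primrec.snd)))).of_eq fun _ => rfl)

theorem primrec_rdiv : Primrec₂ rdiv :=
  Primrec₂.encode_iff.1 ((Primrec.succ.comp (Primrec.succ.comp (Primrec.nat_mul.comp
    (Primrec.const 3) (Primrec₂.natPair.comp (Primrec.encode.comp Primrec.fst)
      (Primrec.encode.comp Primrec.snd))))).of_eq fun _ => rfl)

theorem primrec_lunder : Primrec₂ lunder :=
  Primrec.list_foldl Primrec.fst Primrec.snd
    (primrec_ldiv.comp (Primrec.snd.comp Primrec.snd) (Primrec.fst.comp Primrec.snd)).to₂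

end LForm

namespace Menu

open LForm

variable {ι : Type*} [Primcodable ι]

theorem primrec_lower : Primrec (lower : ι → LForm) := by
  have hm : Primrec (mark : ι → LForm) :=
    primrec_var.comp (Primrec.nat_add.comp (Primrec.nat_mul.comp (Primrec.const 2) Primrec.encode)
      (Primrec.const 2))
  exact primrec_ldiv.comp (primrec_rdiv.comp hm hm) (Primrec.const base)

theorem primrec_cont : Primrec (cont : ι → LForm) :=
  primrec_rdiv.comp (Primrec.const raising)
    (primrec_ldiv.comp primrec_lower (Primrec.const raising))

theorem primrec_phrase : Primrec (phrase : ι → LForm) :=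
  primrec_rdiv.comp (Primrec.const base) primrec_cont

theorem primrec_ruleAtom : Primrec (ruleAtom : ι × List ι → LForm) :=
  primrec_var.comp (Primrec.nat_add.comp (Primrec.nat_mul.comp (Primrec.const 2) Primrec.encode)
    (Primrec.const 3))

theorem primrec_useArg : Primrec (useArg : ι × List ι → LForm) :=
  primrec_lunder.comp (Primrec.list_append.comp
    (Primrec.list_map Primrec.snd (primrec_phrase.comp Primrec.snd).to₂)
    (Primrec.list_cons.comp (primrec_cont.comp Primrec.fst) (Primrec.const [])))
    primrec_ruleAtom

theorem primrec_bound : Primrec (bound : ι × List ι → LForm) :=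
  primrec_lunder.comp (Primrec.list_append.comp
    (Primrec.list_map Primrec.snd (Primrec.const filler).to₂)
    (Primrec.list_cons.comp (primrec_lower.comp Primrec.fst) (Primrec.const [])))
    primrec_ruleAtom

theorem primrec_option : Primrec (option : ι × List ι → LForm) := by
  have hs : Primrec (skipArg : ι × List ι → LForm) :=
    primrec_ldiv.comp (Primrec.const base) primrec_ruleAtom
  exact primrec_rdiv.comp (Primrec.const base) (primrec_rdiv.comp (primrec_rdiv.comp
    (primrec_rdiv.comp primrec_ruleAtom (primrec_ldiv.comp primrec_bound primrec_useArg))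
    primrec_bound) (primrec_rdiv.comp hs primrec_bound))

theorem primrec_letter : Primrec₂ (letter : List (ι × List ι) → ι → LForm) :=
  primrec_rdiv.comp (Primrec.const base) (primrec_lunder.comp (Primrec.list_append.comp
    (Primrec.list_map Primrec.fst (primrec_option.comp Primrec.snd).to₂)
    (Primrec.list_cons.comp (primrec_phrase.comp Primrec.snd) (Primrec.const [])))
    (Primrec.const base))

end Menu

namespace Primrec

variable {α : Type*} [Primcodable α]

theorem list_replicate : Primrec₂ (List.replicate : ℕ → α → List α) :=
  (Primrec.list_map (Primrec.list_range.comp Primrec.fst)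
    (Primrec.snd.comp Primrec.fst).to₂).of_eq fun p => by
      simp [List.map_const']

end Primrec

/-! ### Computability of the transformation -/

namespace CFGData

section Computability

variable {T : Type*} {N : Type} [Primcodable T] [Primcodable N]

theorem primrec_terminal : Primrec (Symbol.terminal : T → Symbol T N) :=
  ((Primrec.of_equiv_symm (e := symbolEquivSum T N)).comp Primrec.sumInl).of_eq fun _ => rfl

theorem primrec_nonterminal : Primrec (Symbol.nonterminal : N → Symbol T N) :=
  ((Primrec.of_equiv_symm (e := symbolEquivSum T N)).comp Primrec.sumInr).of_eq fun _ => rfl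

theorem primrec_input : Primrec (ContextFreeRule.input : ContextFreeRule T N → N) :=
  Primrec.fst.comp (Primrec.of_equiv (e := ruleEquivProd T N))

theorem primrec_output :
    Primrec (ContextFreeRule.output : ContextFreeRule T N → List (Symbol T N)) :=
  Primrec.snd.comp (Primrec.of_equiv (e := ruleEquivProd T N))

theorem primrec_alphabet : Primrec (CFGData.alphabet : CFGData T N → List T) :=
  Primrec.fst.comp (Primrec.of_equiv (e := cfgDataEquivProd T N))

theorem primrec_start : Primrec (CFGData.start : CFGData T N → N) :=
  Primrec.fst.comp (Primrec.snd.comp (Primrec.of_equiv (e := cfgDataEquivProd T N)))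

theorem primrec_rules : Primrec (CFGData.rules : CFGData T N → List (ContextFreeRule T N)) :=
  Primrec.snd.comp (Primrec.snd.comp (Primrec.of_equiv (e := cfgDataEquivProd T N)))

theorem primrec_symbolLabel : Primrec (symbolLabel : Symbol T N → Label T N) :=
  Primrec.pair (Primrec.const []) Primrec.id

theorem primrec_inputs : Primrec (inputs : CFGData T N → List N) :=
  Primrec.list_map primrec_rules (primrec_input.comp Primrec.snd).to₂

theorem primrec_contexts : Primrec (contexts : CFGData T N → List (List (Symbol T N))) :=
  Primrec.list_cons.comp (Primrec.const []) (Primrec.list_map primrec_inputs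
    (Primrec.list_cons.comp (primrec_nonterminal.comp Primrec.snd) (Primrec.const [])).to₂)

theorem primrec_cornerRules :
    Primrec (cornerRules : CFGData T N → List (Label T N × List (Label T N))) := by
  have hβ : Primrec fun p : ((CFGData T N × List (Symbol T N)) × N) × N => p.1.1.2 :=
    Primrec.snd.comp (Primrec.fst.comp Primrec.fst)
  have hA : Primrec fun p : ((CFGData T N × List (Symbol T N)) × N) × N =>
      (Symbol.nonterminal p.1.2 : Symbol T N) :=
    primrec_nonterminal.comp (Primrec.snd.comp Primrec.fst)
  have hD : Primrec fun p : ((CFGData T N × List (Symbol T N)) × N) × N =>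
      (Symbol.nonterminal p.2 : Symbol T N) :=
    primrec_nonterminal.comp Primrec.snd
  exact Primrec.list_flatMap primrec_contexts (Primrec.list_flatMap
    (primrec_inputs.comp Primrec.fst) (Primrec.list_map
      (primrec_inputs.comp (Primrec.fst.comp Primrec.fst))
      (Primrec.pair (Primrec.pair hβ hA) (Primrec.list_cons.comp (Primrec.pair hβ hD)
        (Primrec.list_cons.comp (Primrec.pair (Primrec.list_cons.comp hD (Primrec.const [])) hA)
          (Primrec.const [])))).to₂).to₂).to₂

theorem primrec_drop_output :
    Primrec fun r : ContextFreeRule T N => (r.output.drop 1).map symbolLabel :=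
  Primrec.list_map (Primrec.list_drop.comp (Primrec.const 1) primrec_output)
    (primrec_symbolLabel.comp Primrec.snd).to₂

theorem primrec_expandRules :
    Primrec (expandRules : CFGData T N → List (Label T N × List (Label T N))) :=
  Primrec.list_flatMap primrec_contexts (Primrec.list_map (primrec_rules.comp Primrec.fst)
    (Primrec.pair (Primrec.pair (Primrec.snd.comp Primrec.fst)
        (primrec_nonterminal.comp (primrec_input.comp Primrec.snd)))
      (Primrec.list_append.comp
        (Primrec.list_map
          (Primrec.list_take.comp (Primrec.const 1) (primrec_output.comp Primrec.snd))
          (Primrec.pair (Primrec.snd.comp (Primrec.fst.comp Primrec.fst)) Primrec.snd).to₂)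
        (primrec_drop_output.comp Primrec.snd))).to₂).to₂

theorem primrec_completeRules :
    Primrec (completeRules : CFGData T N → List (Label T N × List (Label T N))) :=
  Primrec.list_map primrec_rules (Primrec.pair
    (Primrec.pair
      (Primrec.list_take.comp (Primrec.const 1) (primrec_output.comp Primrec.snd))
      (primrec_nonterminal.comp (primrec_input.comp Primrec.snd)))
    (primrec_drop_output.comp Primrec.snd)).to₂

end Computability

/-- The optional rules in front of every letter. -/
def blocks {T : Type*} {N : Type} (G : CFGData T N) : List (Label T N × List (Label T N)) :=
  (List.replicate G.stepBound G.leftCornerRules).flatten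

variable {T : Type*} {N : Type} [Primcodable T] [Primcodable N]

theorem primrec_blocks : Primrec (blocks : CFGData T N → List (Label T N × List (Label T N))) := by
  have hR : Primrec (leftCornerRules : CFGData T N → List (Label T N × List (Label T N))) :=
    Primrec.list_append.comp (Primrec.list_append.comp primrec_cornerRules primrec_expandRules)
      primrec_completeRules
  have hK : Primrec (stepBound : CFGData T N → ℕ) :=
    Primrec.nat_add.comp (Primrec.nat_mul.comp (Primrec.const 2)
      (Primrec.list_length.comp primrec_rules)) (Primrec.const 4)
  exact Primrec.list_flatten.comp (Primrec.list_replicate.comp hK hR)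

/-- The type assigned to a letter. -/
def letterType (G : CFGData T N) (a : T) : LForm :=
  Menu.letter G.blocks (symbolLabel (.terminal a))

/-- The Lambek grammar with unique type assignment which generates the same language. -/
def toLambek (G : CFGData T N) : LambekGrammar T where
  alphabet := G.alphabet
  goal := Menu.phrase (symbolLabel (.nonterminal G.start) : Label T N)
  assign := G.alphabet.map fun a => (a, G.letterType a)

theorem primrec_toLambek : Primrec (toLambek : CFGData T N → LambekGrammar T) := by
  have hl : Primrec₂ (letterType : CFGData T N → T → LForm) :=
    Menu.primrec_letter.comp (primrec_blocks.comp Primrec.fst)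
      (primrec_symbolLabel.comp (primrec_terminal.comp Primrec.snd))
  have hg : Primrec fun G : CFGData T N =>
      Menu.phrase (symbolLabel (.nonterminal G.start) : Label T N) :=
    Menu.primrec_phrase.comp (primrec_symbolLabel.comp (primrec_nonterminal.comp primrec_start))
  have ha : Primrec fun G : CFGData T N => G.alphabet.map fun a => (a, G.letterType a) :=
    Primrec.list_map primrec_alphabet
      (Primrec.pair Primrec.snd (hl.comp Primrec.fst Primrec.snd)).to₂
  exact ((Primrec.of_equiv_symm (e := lambekGrammarEquivProd T)).comp
    (primrec_alphabet.pair (hg.pair ha))).of_eq fun _ => rfl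

/-! ### Correctness of the transformation -/

variable {G : CFGData T N}

theorem mem_assign_toLambek {a : T} {A : LForm} :
    (a, A) ∈ G.toLambek.assign ↔ a ∈ G.alphabet ∧ A = G.letterType a := by
  simp [toLambek, eq_comm]

theorem language_toLambek (hW : G.WellFormed) (hG : G.EpsilonFree) :
    G.toLambek.language = G.toGrammar.language := by
  ext w
  rw [mem_language_iff]
  have hmap (w : List T) : (w.map fun a => (symbolLabel (.terminal a) : Label T N)).map
      (Menu.letter G.blocks) = w.map G.letterType := by
    rw [List.map_map]
    rfl
  constructor
  · rintro ⟨Γ, hΓ, hd⟩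
    obtain rfl : Γ = w.map G.letterType := by
      clear hd
      induction hΓ with
      | nil => rfl
      | cons h _ ih => rw [List.map_cons, (mem_assign_toLambek.1 h).2, ← ih]
    rw [← hmap] at hd
    refine yields_of_mem_labelsWords (γ := [.nonterminal G.start])
      ((reads_letterWord (fun r hr => ?_) w).mem_labelsWords hG (Menu.expands_of_lder hd))
    obtain ⟨l, hl, hr⟩ := List.mem_flatten.1 hr
    rwa [List.eq_of_mem_replicate hl] at hr
  · intro h
    refine ⟨w.map G.letterType, ?_, ?_⟩
    · rw [List.forall₂_map_right_iff, List.forall₂_same]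
      exact fun a ha => mem_assign_toLambek.2 ⟨h.mem_alphabet hW (by simp) a ha, rfl⟩
    · have hx := (expandable_of_yields hG h).1 (by simp) [] [] (.nil _)
      have := (hx.mono (k' := G.stepBound) (by unfold stepBound; omega)).lder (Γ := [])
        (by simpa using LDer.ax (Menu.phrase (symbolLabel (.nonterminal G.start) : Label T N)))
      rw [List.append_nil, List.nil_append] at this
      rw [← hmap]
      exact this

end CFGData

theorem theorem5p1 {T : Type*} {N : Type} [Primcodable T] [Primcodable N] :
    ∃ f : CFGData T N → LambekGrammar T, Computable f ∧
      ∀ G : CFGData T N, G.WellFormed → G.EpsilonFree →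
        (f G).alphabet = G.alphabet ∧ (f G).WellFormed ∧ (f G).UniqueType ∧
          (f G).language = G.toGrammar.language := by
  refine ⟨CFGData.toLambek, CFGData.primrec_toLambek.to_comp, fun G hW hG =>
    ⟨rfl, fun p hp => (CFGData.mem_assign_toLambek.1 hp).1, fun a ha => ?_,
      CFGData.language_toLambek hW hG⟩⟩
  exact ⟨_, CFGData.mem_assign_toLambek.2 ⟨ha, rfl⟩,
    fun A hA => (CFGData.mem_assign_toLambek.1 hA).2⟩
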